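/- Let $P$ be a subsemigroup of a (discrete) group $G$, containing the identity element $e$ of $G$. For $X\subseteq P$ and $p\in P$ write $pX=\{px: x\in X\}$ and $p^{-1}X=\{y\in P: py\in X\}$. Let $\mathcal J$ be the family of constructible right ideals of $P$, i.e. the smallest family of right ideals of $P$ that contains $P$ and $\emptyset$, is closed under $X\mapsto pX$ and $X\mapsto p^{-1}X$ for all $p\in P$, and is closed under finite intersections. Let $C^*_s(P)$ be the universal C*-algebra generated by isometries $\{v_p : p\in P\}$ and projections $\{e_X : X\in\mathcal J\}$ subject to the relations 1. $v_{pq}=v_pv_q$ for all $p,q\in P$; 2. $e_\emptyset=0$; 3. whenever $m\ge 1$ and $p_1,q_1,\dots,p_m,q_m\in P$ satisfy $p_1^{-1}q_1\cdots p_m^{-1}q_m=e$ in $G$, then $v_{p_1}^*v_{q_1}\cdots v_{p_m}^*v_{q_m}=e_X$, where $X=q_m^{-1}p_m\cdots q_1^{-1}p_1P$. Then $P$ is left reversible, i.e. $pP\cap qP\neq\emptyset$ for all $p,q\in P$, if and only if there exists a nonzero character on $C^*_s(P)$, i.e. a nonzero multiplicative linear functional $C^*_s(P)\to\mathbb C$.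 -/

import Mathlib

open scoped ENNReal

universe u

section Semigroups

variable {M : Type u} [Monoid M]

/-- A semigroup with unit is left reversible if `pM ∩ qM ≠ ∅` for all `p`, `q`. -/
def IsLeftReversible (M : Type u) [Monoid M] : Prop :=
  ∀ p q : M, (Set.range (fun x : M => p * x) ∩ Set.range (fun x : M => q * x)).Nonempty

/-- The family of constructible right ideals: the smallest family of subsets containing the whole
semigroup and the empty set and closed under images and preimages under left multiplications and
under finite intersections. (All its members are right ideals: `IsConstructible.mul_mem`.) -/
inductive IsConstructible : Set M → Prop
  | univ : IsConstructible Set.univ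
  | empty : IsConstructible ∅
  | image (p : M) {X : Set M} : IsConstructible X → IsConstructible ((fun x => p * x) '' X)
  | preimage (p : M) {X : Set M} : IsConstructible X → IsConstructible ((fun x => p * x) ⁻¹' X)
  | inter {X Y : Set M} : IsConstructible X → IsConstructible Y → IsConstructible (X ∩ Y)

theorem IsConstructible.mul_mem {X : Set M} (hX : IsConstructible X) :
    ∀ {x : M}, x ∈ X → ∀ p : M, x * p ∈ X := by
  induction hX with
  | univ => intro x _ p; trivial
  | empty => intro x hx; exact hx.elim
  | image q _ ih =>
    rintro _ ⟨y, hy, rfl⟩ p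
    exact ⟨y * p, ih hy p, (mul_assoc q y p).symm⟩
  | preimage q _ ih =>
    intro x hx p
    have h := ih hx p
    rwa [mul_assoc] at h
  | inter _ _ ih₁ ih₂ =>
    intro x hx p
    exact ⟨ih₁ hx.1 p, ih₂ hx.2 p⟩

/-- For `l = [(p₁, q₁), …, (pₘ, qₘ)]` this is the right ideal `qₘ⁻¹ pₘ ⋯ q₁⁻¹ p₁ M`, where `p X` is
the image and `q⁻¹ X` the preimage of `X` under left multiplication. -/
def wordIdeal (l : List (M × M)) : Set M :=
  l.foldl (fun X w => (fun y => w.2 * y) ⁻¹' ((fun x => w.1 * x) '' X)) Set.univ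

theorem isConstructible_wordIdeal (l : List (M × M)) : IsConstructible (wordIdeal l) := by
  suffices h : ∀ (l : List (M × M)) (X : Set M), IsConstructible X →
      IsConstructible
        (l.foldl (fun X w => (fun y => w.2 * y) ⁻¹' ((fun x => w.1 * x) '' X)) X) from
    h l _ IsConstructible.univ
  intro l
  induction l with
  | nil => intro X hX; exact hX
  | cons w l ih => intro X hX; exact ih _ ((hX.image w.1).preimage w.2)

end Semigroups

noncomputable section

variable {G : Type u} [Group G]

/-- The index set `𝒥` of the projections: the constructible right ideals of `P`. -/
abbrev ConstructibleIdeal (P : Submonoid G) : Type u := {X : Set P // IsConstructible X}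

/-- Isometries `v p` (`p ∈ P`) and projections `e X` (`X` a constructible right ideal of `P`) in a
unital C⋆-algebra `A`, satisfying the defining relations of `C⋆ₛ(P)`. -/
structure IsSemigroupRep (P : Submonoid G) {A : Type*} [CStarAlgebra A]
    (v : P → A) (e : ConstructibleIdeal P → A) : Prop where
  isometry : ∀ p, star (v p) * v p = 1
  projection : ∀ X, IsStarProjection (e X)
  map_mul : ∀ p q, v (p * q) = v p * v q
  map_empty : e ⟨∅, IsConstructible.empty⟩ = 0
  /-- Whenever `p₁⁻¹ q₁ ⋯ pₘ⁻¹ qₘ = 1` in `G` (`m ≥ 1`), the product `v_{p₁}⋆ v_{q₁} ⋯ v_{pₘ}⋆ v_{qₘ}`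
  is the projection of the ideal `qₘ⁻¹ pₘ ⋯ q₁⁻¹ p₁ P`. -/
  map_word : ∀ l : List (P × P), l ≠ [] →
    (l.map fun w => (w.1 : G)⁻¹ * (w.2 : G)).prod = 1 →
    (l.map fun w => star (v w.1) * v w.2).prod = e ⟨wordIdeal l, isConstructible_wordIdeal l⟩

/-- A representation of the relations in a nonzero unital C⋆-algebra lying in the
universe of `G`; the C⋆-algebra generated by any representation has a copy in that universe. -/
structure SemigroupRep (P : Submonoid G) : Type (u + 1) where
  carrier : Type u
  [cstar : CStarAlgebra carrier]
  [nontrivial : Nontrivial carrier]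
  v : P → carrier
  e : ConstructibleIdeal P → carrier
  isRep : IsSemigroupRep P v e

attribute [instance] SemigroupRep.cstar SemigroupRep.nontrivial

/-- The direct product (in the sense of C⋆-algebras: bounded families with the supremum norm) of
the target algebras of all representations. -/
abbrev RepProduct (P : Submonoid G) : Type (u + 1) :=
  lp (fun ρ : SemigroupRep P => ρ.carrier) ∞

instance (P : Submonoid G) : CStarAlgebra (RepProduct P) where

namespace RepProduct

variable (P : Submonoid G)

/-- The isometry `(v_p)_ρ` in the product of all representations. -/
def v (p : P) : RepProduct P :=
  ⟨fun ρ => ρ.v p, memℓp_infty ⟨1, by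
    rintro _ ⟨ρ, rfl⟩
    have h := CStarRing.norm_star_mul_self (x := ρ.v p)
    rw [ρ.isRep.isometry, CStarRing.norm_one] at h
    dsimp only
    nlinarith [norm_nonneg (ρ.v p)]⟩⟩

/-- The projection `(e_X)_ρ` in the product of all representations. -/
def e (X : ConstructibleIdeal P) : RepProduct P :=
  ⟨fun ρ => ρ.e X, memℓp_infty ⟨1, by
    rintro _ ⟨ρ, rfl⟩
    exact (ρ.isRep.projection X).norm_le⟩⟩

end RepProduct

/-- The universal C⋆-algebra `C⋆ₛ(P)`, realised as the C⋆-algebra generated by the families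
`(v_p)_ρ` and `(e_X)_ρ` in the product over all representations `ρ` of the relations. Its universal
property is `SemigroupCStar.isRep` and `SemigroupCStar.existsUnique_lift`. -/
abbrev SemigroupCStar (P : Submonoid G) : Type (u + 1) :=
  (StarAlgebra.adjoin ℂ
    (Set.range (RepProduct.v P) ∪ Set.range (RepProduct.e P))).topologicalClosure

instance (P : Submonoid G) : CStarAlgebra (SemigroupCStar P) :=
  StarSubalgebra.cstarAlgebra _
    (h_closed := StarSubalgebra.isClosed_topologicalClosure _)

namespace SemigroupCStar

variable (P : Submonoid G)

/-- The generating isometries of `C⋆ₛ(P)`. -/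
def v (p : P) : SemigroupCStar P :=
  ⟨RepProduct.v P p, StarSubalgebra.le_topologicalClosure _
    (StarAlgebra.subset_adjoin ℂ _ (Or.inl ⟨p, rfl⟩))⟩

/-- The generating projections of `C⋆ₛ(P)`. -/
def e (X : ConstructibleIdeal P) : SemigroupCStar P :=
  ⟨RepProduct.e P X, StarSubalgebra.le_topologicalClosure _
    (StarAlgebra.subset_adjoin ℂ _ (Or.inr ⟨X, rfl⟩))⟩

/-- The component of `C⋆ₛ(P)` at a representation. -/
def eval (ρ : SemigroupRep P) : SemigroupCStar P →⋆ₐ[ℂ] ρ.carrier where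
  toFun a := (a : RepProduct P) ρ
  map_one' := rfl
  map_mul' _ _ := rfl
  map_zero' := rfl
  map_add' _ _ := rfl
  commutes' _ := rfl
  map_star' _ := rfl

theorem ext_eval {a b : SemigroupCStar P} (h : ∀ ρ, eval P ρ a = eval P ρ b) : a = b :=
  Subtype.ext (lp.ext (funext h))

/-- The generators of `C⋆ₛ(P)` satisfy the defining relations. -/
theorem isRep : IsSemigroupRep P (v P) (e P) where
  isometry p := ext_eval P fun ρ => by
    rw [map_mul, map_star, map_one]; exact ρ.isRep.isometry p
  projection X :=
    ⟨ext_eval P fun ρ => by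
      rw [map_mul]; exact (ρ.isRep.projection X).isIdempotentElem,
     ext_eval P fun ρ => by
      rw [map_star]; exact (ρ.isRep.projection X).isSelfAdjoint⟩
  map_mul p q := ext_eval P fun ρ => by
    rw [_root_.map_mul]; exact ρ.isRep.map_mul p q
  map_empty := ext_eval P fun ρ => by
    rw [map_zero]; exact ρ.isRep.map_empty
  map_word l hl h := ext_eval P fun ρ => by
    rw [map_list_prod, List.map_map]
    refine Eq.trans (congrArg List.prod (List.map_congr_left fun w _ => ?_))
      (ρ.isRep.map_word l hl h)
    rw [Function.comp_apply, _root_.map_mul, map_star]; rfl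

/-- The universal property of `C⋆ₛ(P)`. -/
theorem existsUnique_lift {A : Type u} [CStarAlgebra A] {v' : P → A}
    {e' : ConstructibleIdeal P → A} (h : IsSemigroupRep P v' e') :
    ∃! φ : SemigroupCStar P →⋆ₐ[ℂ] A, (∀ p, φ (v P p) = v' p) ∧ ∀ X, φ (e P X) = e' X := by
  cases subsingleton_or_nontrivial A with
  | inl _ =>
    refine ⟨{ toFun := 0, map_one' := Subsingleton.elim _ _, map_mul' _ _ := Subsingleton.elim _ _,
              map_zero' := rfl, map_add' _ _ := Subsingleton.elim _ _,
              commutes' _ := Subsingleton.elim _ _, map_star' _ := Subsingleton.elim _ _ },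
      ⟨fun _ => Subsingleton.elim _ _, fun _ => Subsingleton.elim _ _⟩, fun φ _ => ?_⟩
    exact StarAlgHom.ext fun _ => Subsingleton.elim _ _
  | inr _ =>
    refine ⟨eval P ⟨A, v', e', h⟩, ⟨fun _ => rfl, fun _ => rfl⟩, fun φ hφ => ?_⟩
    refine StarAlgHom.ext_topologicalClosure
      (AddMonoidHomClass.continuous_of_bound φ 1 fun a => by
        simpa using NonUnitalStarAlgHom.norm_apply_le φ a)
      (AddMonoidHomClass.continuous_of_bound (eval P ⟨A, v', e', h⟩) 1 fun a => by
        simpa using NonUnitalStarAlgHom.norm_apply_le (eval P ⟨A, v', e', h⟩) a) ?_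
    refine StarAlgHom.ext_adjoin ?_
    rintro ⟨x, hx⟩ (⟨p, rfl⟩ | ⟨X, rfl⟩)
    · exact hφ.1 p
    · exact hφ.2 X

end SemigroupCStar

end

/-! Left reversibility keeps every ideal `wordIdeal l` nonempty, so sending each isometry to 1 and
each nonempty ideal to 1 respects the relations; universality turns this into a character.
Conversely, a character cannot vanish on any `v p` or its adjoint, since their product is 1. But if
`pP ∩ qP = ∅`, the word relation makes a product of such elements equal to the projection of `∅`,
which is 0 (`IsSemigroupRep.mul_star_mul_eq_zero`). -/

theorem nonempty_wordIdeal {M : Type u} [Monoid M] (hM : IsLeftReversible M) (l : List (M × M)) :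
    (wordIdeal l).Nonempty := by
  suffices h : ∀ (l : List (M × M)) (X : Set M), IsConstructible X → X.Nonempty →
      (l.foldl (fun X w => (fun y => w.2 * y) ⁻¹' ((fun x => w.1 * x) '' X)) X).Nonempty from
    h l _ IsConstructible.univ ⟨1, trivial⟩
  intro l
  induction l with
  | nil => intro X _ hX; exact hX
  | cons w l ih =>
    rintro X hX ⟨x, hx⟩
    refine ih _ ((hX.image w.1).preimage w.2) ?_
    -- Reversibility gives `w.1 * x * a = w.2 * b`; as `X` is a right ideal, `x * a` stays in `X`,
    -- so `b` lies in the next ideal.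
    obtain ⟨_, ⟨a, rfl⟩, b, hb⟩ := hM (w.1 * x) w.2
    exact ⟨b, x * a, hX.mul_mem hx a, (mul_assoc _ _ _).symm.trans hb.symm⟩

open scoped Classical in
/-- If `P` is left reversible, then `v p = 1`, and `e X = 1` for `X ≠ ∅`, defines a representation
on the one-dimensional C⋆-algebra. -/
theorem isSemigroupRep_one {G : Type u} [Group G] {P : Submonoid G} (hP : IsLeftReversible P)
    (A : Type*) [CStarAlgebra A] :
    IsSemigroupRep P (fun _ => (1 : A))
      (fun X : ConstructibleIdeal P => if (X : Set P).Nonempty then 1 else 0) where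
  isometry _ := by simp
  projection X := by
    split_ifs
    · exact .one A
    · exact .zero A
  map_mul _ _ := (mul_one 1).symm
  map_empty := if_neg Set.not_nonempty_empty
  map_word l _ _ := by
    rw [if_pos (nonempty_wordIdeal hP l)]
    simp

/-- If `pP` and `qP` are disjoint, then the range projections of `v p` and `v q` are orthogonal. -/
theorem IsSemigroupRep.mul_star_mul_eq_zero {G : Type u} [Group G] {P : Submonoid G} {A : Type*}
    [CStarAlgebra A] {v : P → A} {e : ConstructibleIdeal P → A} (h : IsSemigroupRep P v e)
    {p q : P}
    (hpq : ¬ (Set.range (fun x : P => p * x) ∩ Set.range (fun x : P => q * x)).Nonempty) :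
    star (v 1) * v p * (star (v p) * v q) * (star (v q) * v 1) = 0 := by
  have hw : wordIdeal [(1, p), (p, q), (q, 1)] = (∅ : Set P) := by
    refine Set.eq_empty_of_forall_notMem fun x hx => hpq ?_
    obtain ⟨y, ⟨z, -, hz⟩, -⟩ := hx
    exact ⟨q * y, ⟨z, hz⟩, y, rfl⟩
  have hl := h.map_word [(1, p), (p, q), (q, 1)] (List.cons_ne_nil _ _) (by simp)
  have he : e ⟨_, isConstructible_wordIdeal [(1, p), (p, q), (q, 1)]⟩ = 0 := by
    rw [← h.map_empty]
    exact congrArg e (Subtype.ext hw)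
  rw [he] at hl
  simpa [mul_assoc] using hl

theorem mainTheorem10 {G : Type u} [Group G] (P : Submonoid G) :
    IsLeftReversible P ↔ (WeakDual.characterSpace ℂ (SemigroupCStar P)).Nonempty := by
  constructor
  · intro hP
    obtain ⟨φ, -⟩ :=
      -- The functions on a point are a copy of `ℂ` in the universe of `G`, as the universal
      -- property requires.
      (SemigroupCStar.existsUnique_lift P (isSemigroupRep_one hP (PUnit.{u + 1} → ℂ))).exists
    exact ⟨_, (WeakDual.CharacterSpace.equivAlgHom.symm
      ((Pi.evalAlgHom ℂ (fun _ : PUnit.{u + 1} => ℂ) PUnit.unit).comp φ.toAlgHom)).2⟩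
  · rintro ⟨χ, hχ⟩ p q
    by_contra hpq
    let ψ := WeakDual.CharacterSpace.toAlgHom (⟨χ, hχ⟩ : WeakDual.characterSpace ℂ _)
    have hv : ∀ p, ψ (star (SemigroupCStar.v P p)) * ψ (SemigroupCStar.v P p) = 1 := fun p => by
      rw [← map_mul, (SemigroupCStar.isRep P).isometry, map_one]
    have hv₁ p := left_ne_zero_of_mul_eq_one (hv p)
    have hv₂ p := right_ne_zero_of_mul_eq_one (hv p)
    have h := congrArg ψ ((SemigroupCStar.isRep P).mul_star_mul_eq_zero hpq)
    -- A product of six nonzero complex numbers would be 0.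
    simp only [map_mul, map_zero, mul_eq_zero, hv₁, hv₂, or_self] at h
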